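/- Let $n\ge 0$, let $\varphi(x)=-x/|x|^2$ for $x\in\mathbb R\setminus\{0\}$, and let $$\mathcal Z_n^1=\{(x_1,\dots,x_n)\in(\mathbb R\setminus\{0\})^n:\ x_i\ne x_j \text{ and } x_i\neq\varphi(x_j)\text{ for all } i\neq j\}.$$ Let $[n]^{\pm}=\{1,\bar1,\dots,n,\bar n\}$ with $\bar{\bar i}=i$, and write $x_{\bar i}=\varphi(x_i)$ for $i\in\{1,\dots,n\}$. There is a ring isomorphism (in particular an isomorphism of $\mathbb Z$-modules) $$\mathbb Z[z_{ij},z_i]/\mathcal J\;\cong\; H^*(\mathcal Z_n^1;\mathbb Z),$$ where $H^*$ is the total singular cohomology ring with the cup product, the polynomial ring has one variable $z_{ij}$ for each ordered pair $i\ne j$ in $[n]^{\pm}$ and one variable $z_i$ for each $i\in[n]^{\pm}$, and $\mathcal J$ is the ideal generated by the following elements, for all $i,j,k\in[n]^\pm$ such that every variable $z_{ab}$ that occurs has $a\neq b$: - (i) $z_{ij}(1-z_{ij})$ - (ii) $z_i(1-z_i)$ - (iii) $z_i-z_j+z_{ij}-z_{\bar i\bar j}$ - (iv) $z_i-(1-z_{\bar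 i})$ - (v) $z_{ij}z_{jk}(1-z_{ik})+(1-z_{ij})(1-z_{jk})z_{ik}$ - (vi) $z_{ij}z_i(1-z_j)+(1-z_{ij})(1-z_i)z_j$ - (vii) $z_jz_{i\bar j}(1-z_{ij})+(1-z_j)(1-z_{i\bar j})z_{ij}$ together with the antisymmetry relations $z_{ij}-(1-z_{ji})$ for $i\ne j$ in $[n]^\pm$. The isomorphism sends $z_{ij}$ and $z_i$ to the classes in $H^0(\mathcal Z_n^1;\mathbb Z)$ of the signed Heaviside functions $$z_{ij}(x)=\begin{cases}1& x_i<x_j\\0&\text{otherwise,}\end{cases}\qquad z_i(x)=\begin{cases}1& x_i>0\\0&\text{otherwise.}\end{cases}$$ -/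

import Mathlib

/-! ### The singular cohomology ring with integer coefficients -/

namespace SSetCohomology

open CategoryTheory

/-- The `k`-simplices of a simplicial set. -/
abbrev Simplex (S : SSet.{0}) (k : ℕ) : Type := S.obj (Opposite.op (SimplexCategory.mk k))

/-- Integral `k`-cochains of a simplicial set: arbitrary functions on the set of `k`-simplices. -/
abbrev Cochain (S : SSet.{0}) (k : ℕ) : Type := Simplex S k → ℤ

/-- The coboundary, `(d f)(σ) = ∑ i, (-1)^i f(σ with its i-th vertex deleted)`. -/
def d (S : SSet.{0}) (k : ℕ) : Cochain S k →+ Cochain S (k + 1) where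
  toFun f σ := ∑ i : Fin (k + 2), (-1 : ℤ) ^ (i : ℕ) * f (S.δ i σ)
  map_zero' := by funext σ; simp
  map_add' f g := by funext σ; simp [mul_add, Finset.sum_add_distrib]

theorem d_apply {S : SSet.{0}} {k : ℕ} (f : Cochain S k) (σ : Simplex S (k + 1)) :
    d S k f σ = ∑ i : Fin (k + 2), (-1 : ℤ) ^ (i : ℕ) * f (S.δ i σ) := rfl

/-- The face of `σ` spanned by the consecutive vertices `j, j + 1, …, j + l`. -/
def face {S : SSet.{0}} {n : ℕ} (j l : ℕ) (h : j + l ≤ n) (σ : Simplex S n) : Simplex S l :=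
  S.map (SimplexCategory.subinterval j l h).op σ

/-- The cup product of cochains: `f` of the front `p`-face times `g` of the back `q`-face. -/
def cup {S : SSet.{0}} {p q : ℕ} (f : Cochain S p) (g : Cochain S q) : Cochain S (p + q) :=
  fun σ => f (face 0 p (by omega) σ) * g (face p q le_rfl σ)

/-- `k`-cocycles. -/
def Z (S : SSet.{0}) (k : ℕ) : AddSubgroup (Cochain S k) := (d S k).ker

/-- `k`-coboundaries. -/
def B (S : SSet.{0}) : (k : ℕ) → AddSubgroup (Cochain S k)
  | 0 => ⊥
  | k + 1 => (d S k).range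

/-- The coboundaries, as a subgroup of the cocycles. -/
abbrev BZ (S : SSet.{0}) (k : ℕ) : AddSubgroup (Z S k) := (B S k).addSubgroupOf (Z S k)

/-- The `k`-th integral cohomology group: cocycles modulo coboundaries. -/
abbrev H (S : SSet.{0}) (k : ℕ) : Type := Z S k ⧸ BZ S k

theorem face_congr {S : SSet.{0}} {n m : ℕ} {j l a : ℕ} {h : j + l ≤ n} {h' : a + l ≤ m}
    (τ : SimplexCategory.mk m ⟶ SimplexCategory.mk n)
    (e : SimplexCategory.subinterval a l h' ≫ τ = SimplexCategory.subinterval j l h)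
    (σ : Simplex S n) :
    face a l h' (S.map τ.op σ) = face j l h σ := by
  simp only [face, ← Functor.map_comp_apply, ← op_comp, e]

/-- The underlying map on vertices, with values in `ℕ`. -/
def val {a b : ℕ} (f : SimplexCategory.mk a ⟶ SimplexCategory.mk b) (i : Fin (a + 1)) : ℕ :=
  (f.toOrderHom i).val

theorem hom_ext_val {a b : ℕ} {f g : SimplexCategory.mk a ⟶ SimplexCategory.mk b}
    (h : ∀ i, val f i = val g i) : f = g := by
  ext i
  exact h i

theorem val_sub {n j l : ℕ} (h : j + l ≤ n) (i : Fin (l + 1)) :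
    val (SimplexCategory.subinterval (n := n) j l h) i = i + j := rfl

theorem val_δ {n : ℕ} (i : Fin (n + 2)) (k : Fin (n + 1)) :
    val (SimplexCategory.δ i) k = if (k : ℕ) < i then (k : ℕ) else k + 1 := by
  change ((i.succAbove k : Fin (n + 2)) : ℕ) = _
  simp only [Fin.succAbove, Fin.lt_def, Fin.val_castSucc]
  split_ifs <;> rfl

theorem val_sub_comp {n m j l : ℕ} (h : j + l ≤ n)
    (f : SimplexCategory.mk n ⟶ SimplexCategory.mk m) (i : Fin (l + 1)) :
    val (SimplexCategory.subinterval j l h ≫ f) i = val f ⟨i + j, by omega⟩ := rfl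

theorem val_δ_comp {n m : ℕ} (k : Fin (n + 2))
    (f : SimplexCategory.mk (n + 1) ⟶ SimplexCategory.mk m) (i : Fin (n + 1)) :
    val (SimplexCategory.δ k ≫ f) i = val f (k.succAbove i) := rfl

theorem face_face {S : SSet.{0}} {n m j l a b : ℕ} {h : j + m ≤ n} {h' : a + l ≤ m}
    {h'' : b + l ≤ n} (e : j + a = b) (σ : Simplex S n) :
    face a l h' (face j m h σ) = face b l h'' σ := by
  refine face_congr _ (hom_ext_val fun i => ?_) σ
  rw [val_sub_comp, val_sub, val_sub]
  simp only
  omega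

theorem face_self {S : SSet.{0}} {n : ℕ} (h : 0 + n ≤ n) (σ : Simplex S n) :
    face 0 n h σ = σ := by
  have e : SimplexCategory.subinterval 0 n h = 𝟙 (SimplexCategory.mk n) :=
    hom_ext_val fun i => rfl
  simp [face, e]

theorem face_δ_of_lt {S : SSet.{0}} {n j l : ℕ} {h : j + l ≤ n} {h' : j + l ≤ n + 1}
    (i : Fin (n + 2)) (hi : j + l < i) (σ : Simplex S (n + 1)) :
    face j l h (S.δ i σ) = face j l h' σ := by
  refine face_congr (SimplexCategory.δ i) (hom_ext_val fun k => ?_) σ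
  rw [val_sub_comp, val_δ, val_sub]
  simp only
  split_ifs <;> omega

theorem face_δ_of_le {S : SSet.{0}} {n j l : ℕ} {h : j + l ≤ n} {h' : j + 1 + l ≤ n + 1}
    (i : Fin (n + 2)) (hi : i ≤ j) (σ : Simplex S (n + 1)) :
    face j l h (S.δ i σ) = face (j + 1) l h' σ := by
  refine face_congr (SimplexCategory.δ i) (hom_ext_val fun k => ?_) σ
  rw [val_sub_comp, val_δ, val_sub]
  simp only
  split_ifs <;> omega

theorem face_δ {S : SSet.{0}} {n j l : ℕ} {h : j + l ≤ n} {h' : j + (l + 1) ≤ n + 1}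
    (i : Fin (n + 2)) (k : Fin (l + 2)) (hi : (i : ℕ) = j + k) (σ : Simplex S (n + 1)) :
    face j l h (S.δ i σ) = S.δ k (face j (l + 1) h' σ) := by
  have e : SimplexCategory.subinterval j l h ≫ SimplexCategory.δ i =
      SimplexCategory.δ k ≫ SimplexCategory.subinterval j (l + 1) h' := by
    refine hom_ext_val fun m => ?_
    have := val_δ k m
    change (k.succAbove m).val = _ at this
    rw [val_sub_comp, val_δ, val_δ_comp, val_sub, this]
    simp only
    split_ifs <;> omega
  simp only [face, SimplicialObject.δ, ← Functor.map_comp_apply, ← op_comp, e]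

theorem δ_last_face {S : SSet.{0}} {n l : ℕ} {h : 0 + (l + 1) ≤ n} {h' : 0 + l ≤ n}
    (σ : Simplex S n) :
    S.δ (Fin.last (l + 1)) (face 0 (l + 1) h σ) = face 0 l h' σ := by
  have e : SimplexCategory.δ (Fin.last (l + 1)) ≫ SimplexCategory.subinterval (n := n) 0 (l + 1) h
      = SimplexCategory.subinterval 0 l h' := by
    refine hom_ext_val fun m => ?_
    rw [val_δ_comp, val_sub, val_sub]
    simp
  simp only [face, SimplicialObject.δ, ← Functor.map_comp_apply, ← op_comp, e]

theorem δ_zero_face {S : SSet.{0}} {n j l : ℕ} {h : j + (l + 1) ≤ n} {h' : j + 1 + l ≤ n}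
    (σ : Simplex S n) :
    S.δ 0 (face j (l + 1) h σ) = face (j + 1) l h' σ := by
  have e : SimplexCategory.δ 0 ≫ SimplexCategory.subinterval (n := n) j (l + 1) h
      = SimplexCategory.subinterval (j + 1) l h' := by
    refine hom_ext_val fun m => ?_
    rw [val_δ_comp, val_sub, val_sub]
    simp
    omega
  simp only [face, SimplicialObject.δ, ← Functor.map_comp_apply, ← op_comp, e]

/-- The Leibniz rule `d (f ⌣ g) = d f ⌣ g + (-1)^p f ⌣ d g`, evaluated on a simplex. -/
theorem d_cup {S : SSet.{0}} {p q : ℕ} (f : Cochain S p) (g : Cochain S q)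
    (σ : Simplex S (p + q + 1)) :
    d S (p + q) (cup f g) σ =
      d S p f (face 0 (p + 1) (by omega) σ) * g (face (p + 1) q (by omega) σ) +
        (-1) ^ p * (f (face 0 p (by omega) σ) * d S q g (face p (q + 1) le_rfl σ)) := by
  rw [d_apply, d_apply, d_apply, Fin.sum_univ_castSucc (n := p + 1), Fin.sum_univ_succ (n := q + 1),
    δ_last_face (h' := by omega), δ_zero_face (h' := by omega)]
  have hcast : p + q + 2 = (p + 1) + (q + 1) := by omega
  rw [← (finCongr hcast).symm.sum_comp, Fin.sum_univ_add]
  have h1 : ∀ i : Fin (p + 1),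
      (-1 : ℤ) ^ (((finCongr hcast).symm (Fin.castAdd (q + 1) i)) : ℕ) *
        cup f g (S.δ ((finCongr hcast).symm (Fin.castAdd (q + 1) i)) σ) =
      ((-1) ^ ((i.castSucc : Fin (p + 2)) : ℕ) *
        f (S.δ i.castSucc (face 0 (p + 1) (by omega) σ))) *
        g (face (p + 1) q (by omega) σ) := by
    intro i
    have hi := i.2
    rw [cup, face_δ (h' := by omega) _ i.castSucc (by simp) σ,
      face_δ_of_le (h' := by omega) _ (by simp; omega) σ]
    simp [mul_assoc]
  have h2 : ∀ i : Fin (q + 1),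
      (-1 : ℤ) ^ (((finCongr hcast).symm (Fin.natAdd (p + 1) i)) : ℕ) *
        cup f g (S.δ ((finCongr hcast).symm (Fin.natAdd (p + 1) i)) σ) =
      (-1) ^ p * (f (face 0 p (by omega) σ) *
        ((-1) ^ (i.succ : ℕ) * g (S.δ i.succ (face p (q + 1) le_rfl σ)))) := by
    intro i
    rw [cup, face_δ_of_lt (h' := by omega) _ (by simp; omega) σ,
      face_δ (h' := by omega) _ i.succ (by simp; omega) σ]
    simp
    ring
  rw [Finset.sum_congr rfl fun i _ => h1 i, Finset.sum_congr rfl fun i _ => h2 i,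
    ← Finset.sum_mul, ← Finset.mul_sum, ← Finset.mul_sum]
  simp
  ring

theorem mem_B_of_eq {S : SSet.{0}} {m k : ℕ} (e : m + 1 = k) (g : Cochain S m) (f : Cochain S k)
    (hf : ∀ σ : Simplex S (m + 1), f (face 0 k (by omega) σ) = d S m g σ) : f ∈ B S k := by
  subst e
  refine ⟨g, funext fun σ => ?_⟩
  rw [← hf σ, face_self]

theorem cup_mem_Z {S : SSet.{0}} {p q : ℕ} {f : Cochain S p} {g : Cochain S q}
    (hf : f ∈ Z S p) (hg : g ∈ Z S q) : cup f g ∈ Z S (p + q) := by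
  have hf' : d S p f = 0 := hf
  have hg' : d S q g = 0 := hg
  change d S (p + q) (cup f g) = 0
  funext σ
  rw [d_cup, hf', hg']
  simp

theorem cup_mem_B_left {S : SSet.{0}} {p q : ℕ} {f : Cochain S p} {g : Cochain S q}
    (hf : f ∈ B S p) (hg : g ∈ Z S q) : cup f g ∈ B S (p + q) := by
  have hg' : d S q g = 0 := hg
  cases p with
  | zero =>
    have : f = 0 := hf
    subst this
    convert (B S (0 + q)).zero_mem
    funext σ
    simp [cup]
  | succ p =>
    obtain ⟨f', rfl⟩ := hf
    refine mem_B_of_eq (by omega) (cup f' g) _ fun σ => ?_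
    rw [d_cup, hg', cup, face_face (b := 0) (h'' := by omega) (by omega),
      face_face (b := p + 1) (h'' := by omega) (by omega)]
    simp

theorem cup_mem_B_right {S : SSet.{0}} {p q : ℕ} {f : Cochain S p} {g : Cochain S q}
    (hf : f ∈ Z S p) (hg : g ∈ B S q) : cup f g ∈ B S (p + q) := by
  have hf' : d S p f = 0 := hf
  cases q with
  | zero =>
    have : g = 0 := hg
    subst this
    convert (B S (p + 0)).zero_mem
    funext σ
    simp [cup]
  | succ q =>
    obtain ⟨g', rfl⟩ := hg
    refine mem_B_of_eq (by omega) ((-1 : ℤ) ^ p • cup f g') _ fun σ => ?_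
    rw [map_zsmul, Pi.smul_apply, d_cup, hf', cup, face_face (b := 0) (h'' := by omega) (by omega),
      face_face (b := p) (h'' := by omega) (by omega)]
    simp [← mul_assoc, ← pow_add]

/-- The cup product of cocycles. -/
def cupZ {S : SSet.{0}} {p q : ℕ} (f : Z S p) (g : Z S q) : Z S (p + q) :=
  ⟨cup f g, cup_mem_Z f.2 g.2⟩

theorem cupZ_add_left {S : SSet.{0}} {p q : ℕ} (f f' : Z S p) (g : Z S q) :
    cupZ (f + f') g = cupZ f g + cupZ f' g := by
  ext σ; simp [cupZ, cup, add_mul]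

theorem cupZ_add_right {S : SSet.{0}} {p q : ℕ} (f : Z S p) (g g' : Z S q) :
    cupZ f (g + g') = cupZ f g + cupZ f g' := by
  ext σ; simp [cupZ, cup, mul_add]

/-- The cohomology class of a cocycle. -/
def cls {S : SSet.{0}} {k : ℕ} : Z S k →+ H S k := QuotientAddGroup.mk' (BZ S k)

theorem cls_surjective {S : SSet.{0}} {k : ℕ} : Function.Surjective (cls (S := S) (k := k)) :=
  QuotientAddGroup.mk'_surjective _

theorem cls_eq_zero {S : SSet.{0}} {k : ℕ} {f : Z S k} (hf : (f : Cochain S k) ∈ B S k) :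
    cls f = 0 :=
  (QuotientAddGroup.eq_zero_iff f).2 hf

/-- The cup product on cohomology, `[f] ⌣ [g] = [f ⌣ g]`. -/
def cupH {S : SSet.{0}} {p q : ℕ} : H S p →+ H S q →+ H S (p + q) :=
  QuotientAddGroup.lift (BZ S p)
    (AddMonoidHom.mk' (fun f => QuotientAddGroup.lift (BZ S q)
        (AddMonoidHom.mk' (fun g => cls (cupZ f g)) fun g g' => by
          rw [cupZ_add_right, map_add])
        fun g hg => cls_eq_zero (cup_mem_B_right f.2 hg))
      fun f f' => by
        refine AddMonoidHom.ext fun x => ?_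
        obtain ⟨g, rfl⟩ := cls_surjective x
        change cls (cupZ (f + f') g) = cls (cupZ f g) + cls (cupZ f' g)
        rw [cupZ_add_left, map_add])
    fun f hf => by
      refine AddMonoidHom.ext fun x => ?_
      obtain ⟨g, rfl⟩ := cls_surjective x
      exact cls_eq_zero (cup_mem_B_left hf g.2)

theorem cupH_cls {S : SSet.{0}} {p q : ℕ} (f : Z S p) (g : Z S q) :
    cupH (cls f) (cls g) = cls (cupZ f g) := rfl

/-- The constant `0`-cocycle with value `c`. -/
def constZ (S : SSet.{0}) (c : ℤ) : Z S 0 :=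
  ⟨fun _ => c, by
    change d S 0 (fun _ => c) = 0
    funext σ
    simp [d_apply, Fin.sum_univ_two]⟩

/-- The class of the constant `0`-cocycle with value `c`. -/
def constH (S : SSet.{0}) : ℤ →+ H S 0 :=
  cls.comp (AddMonoidHom.mk' (constZ S) fun _ _ => rfl)

theorem mk_cls_eq {S : SSet.{0}} {m n : ℕ} (e : m = n) (f : Z S m) (g : Z S n)
    (h : ∀ σ : Simplex S n, f.1 (face 0 m (by omega) σ) = g.1 σ) :
    GradedMonoid.mk (A := H S) m (cls f) = GradedMonoid.mk n (cls g) := by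
  subst e
  congr 2
  ext σ
  rw [← h σ, face_self]

instance gmul (S : SSet.{0}) : GradedMonoid.GMul (H S) where
  mul a b := cupH a b

instance gone (S : SSet.{0}) : GradedMonoid.GOne (H S) where
  one := constH S 1

instance gmonoid (S : SSet.{0}) : GradedMonoid.GMonoid (H S) where
  one_mul := by
    rintro ⟨n, a⟩
    obtain ⟨f, rfl⟩ := cls_surjective a
    refine mk_cls_eq (zero_add n) (cupZ (constZ S 1) f) f fun σ => ?_
    change 1 * f.1 (face 0 n _ (face 0 (0 + n) _ σ)) = f.1 σ
    rw [face_face (b := 0) (h'' := by omega) (by omega), face_self, one_mul]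
  mul_one := by
    rintro ⟨n, a⟩
    obtain ⟨f, rfl⟩ := cls_surjective a
    refine mk_cls_eq (add_zero n) (cupZ f (constZ S 1)) f fun σ => ?_
    change f.1 (face 0 n _ (face 0 (n + 0) _ σ)) * 1 = f.1 σ
    rw [face_face (b := 0) (h'' := by omega) (by omega), face_self, mul_one]
  mul_assoc := by
    rintro ⟨m, a⟩ ⟨n, b⟩ ⟨k, c⟩
    obtain ⟨f, rfl⟩ := cls_surjective a
    obtain ⟨g, rfl⟩ := cls_surjective b
    obtain ⟨h, rfl⟩ := cls_surjective c
    refine mk_cls_eq (add_assoc m n k) (cupZ (cupZ f g) h) (cupZ f (cupZ g h)) fun σ => ?_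
    change f.1 (face 0 m _ (face 0 (m + n) _ (face 0 (m + n + k) _ σ))) *
        g.1 (face m n _ (face 0 (m + n) _ (face 0 (m + n + k) _ σ))) *
        h.1 (face (m + n) k _ (face 0 (m + n + k) _ σ)) =
      f.1 (face 0 m _ σ) * (g.1 (face 0 n _ (face m (n + k) _ σ)) *
        h.1 (face n k _ (face m (n + k) _ σ)))
    rw [face_face (j := 0) (m := m + n + k) (b := 0) (h'' := by omega) (by omega),
      face_face (j := 0) (m := m + n) (b := 0) (h'' := by omega) (by omega),
      face_face (j := 0) (m := m + n) (b := m) (h'' := by omega) (by omega),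
      face_face (j := 0) (m := m + n + k) (b := m + n) (h'' := by omega) (by omega),
      face_face (j := m) (m := n + k) (b := m) (h'' := by omega) (by omega),
      face_face (j := m) (m := n + k) (b := m + n) (h'' := by omega) (by omega),
      mul_assoc]

/-- Integral cohomology is a graded ring under the cup product. -/
instance gring (S : SSet.{0}) : DirectSum.GRing (H S) where
  mul_zero a := map_zero (cupH a)
  zero_mul b := by change cupH 0 b = 0; simp
  mul_add a b c := map_add (cupH a) _ _
  add_mul a b c := by change cupH (a + b) c = cupH a c + cupH b c; simp
  natCast n := constH S n
  natCast_zero := map_zero _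
  natCast_succ n := by rw [Nat.cast_succ, map_add]; rfl
  intCast n := constH S n
  intCast_ofNat n := rfl
  intCast_negSucc_ofNat n := by rw [Int.negSucc_eq, map_neg]; simp

end SSetCohomology

/-- The total singular cohomology ring `H^*(X; ℤ) = ⨁ k, H^k(X; ℤ)` with the cup product: the
cohomology ring of the simplicial set of singular simplices of `X`. -/
abbrev SingularCohomology (X : Type) [TopologicalSpace X] : Type :=
  DirectSum ℕ (SSetCohomology.H (TopCat.toSSet.obj (TopCat.of X)))

/-- `IsClassOf f a`: the function `f`, regarded as a singular `0`-cochain of `X` through the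
identification of singular `0`-simplices with points, is a cocycle, and `a` is its class in
`H^0(X; ℤ)`. -/
def IsClassOf {X : Type} [TopologicalSpace X] (f : X → ℤ) (a : SingularCohomology X) : Prop :=
  ∃ c : SSetCohomology.Z (TopCat.toSSet.obj (TopCat.of X)) 0,
    (∀ x : X, c.1 ((TopCat.toSSetObj₀Equiv (X := TopCat.of X)).symm x) = f x) ∧
      a = DirectSum.of (SSetCohomology.H (TopCat.toSSet.obj (TopCat.of X))) 0
        (SSetCohomology.cls c)

/-! ### The orbit configuration space and its Heaviside functions -/

namespace OrbitConfiguration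

/-- The involution `φ(x) = -x / |x|²` of `ℝ ∖ {0}`. -/
noncomputable def phi (x : ℝ) : ℝ := -x / |x| ^ 2

/-- The space of `n`-tuples of nonzero reals with `x_i ≠ x_j` and `x_i ≠ φ(x_j)` for `i ≠ j`. -/
abbrev ZSpace (n : ℕ) : Type :=
  {x : Fin n → ℝ // (∀ i, x i ≠ 0) ∧ ∀ i j, i ≠ j → x i ≠ x j ∧ x i ≠ phi (x j)}

/-- The signed index set `[n]^±`: `Sum.inl i` is `i`, and `Sum.inr i` is its barred copy. -/
abbrev Signed (n : ℕ) : Type := Fin n ⊕ Fin n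

/-- The bar involution of the signed index set. -/
def bar {n : ℕ} (i : Signed n) : Signed n := i.swap

/-- The point with signed index `i` of a configuration: `x_i` for an unbarred index, `φ(x_i)` for a
barred one. -/
noncomputable def point {n : ℕ} (x : ZSpace n) : Signed n → ℝ
  | Sum.inl i => x.1 i
  | Sum.inr i => phi (x.1 i)

open Classical in
/-- The signed Heaviside function `z_{ij}`: `1` if the point of `i` is less than that of `j`, and
`0` otherwise. -/
noncomputable def heavisidePair {n : ℕ} (i j : Signed n) (x : ZSpace n) : ℤ :=
  if point x i < point x j then 1 else 0

open Classical in
/-- The signed Heaviside function `z_i`: `1` if the point of `i` is positive, and `0` otherwise. -/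
noncomputable def heavisideSingle {n : ℕ} (i : Signed n) (x : ZSpace n) : ℤ :=
  if 0 < point x i then 1 else 0

/-- The generators: `z_{ij}` for `i ≠ j` in `[n]^±`, and `z_i` for `i` in `[n]^±`. -/
inductive Gen (n : ℕ) : Type
  | pair (i j : Signed n) (h : i ≠ j) : Gen n
  | single (i : Signed n) : Gen n

/-- The variable `z_{ij}`. -/
noncomputable abbrev zz {n : ℕ} (i j : Signed n) (h : i ≠ j) : MvPolynomial (Gen n) ℤ :=
  MvPolynomial.X (Gen.pair i j h)

/-- The variable `z_i`. -/
noncomputable abbrev z {n : ℕ} (i : Signed n) : MvPolynomial (Gen n) ℤ :=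
  MvPolynomial.X (Gen.single i)

theorem bar_ne {n : ℕ} {i j : Signed n} (h : i ≠ j) : bar i ≠ bar j := fun e =>
  h (by have := congrArg Sum.swap e; simpa [bar] using this)

/-- The defining relations, with signed indices; a relation is imposed whenever every `z_{ij}`
occurring in it has distinct indices. -/
inductive Rel (n : ℕ) : MvPolynomial (Gen n) ℤ → Prop
  | idem_pair (i j : Signed n) (h : i ≠ j) :
      Rel n (zz i j h * (1 - zz i j h))
  | idem_single (i : Signed n) :
      Rel n (z i * (1 - z i))
  | bar_pair (i j : Signed n) (h : i ≠ j) :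
      Rel n (z i - z j + zz i j h - zz (bar i) (bar j) (bar_ne h))
  | bar_single (i : Signed n) :
      Rel n (z i - (1 - z (bar i)))
  | triple (i j k : Signed n) (hij : i ≠ j) (hjk : j ≠ k) (hik : i ≠ k) :
      Rel n (zz i j hij * zz j k hjk * (1 - zz i k hik) +
        (1 - zz i j hij) * (1 - zz j k hjk) * zz i k hik)
  | mixed_single (i j : Signed n) (h : i ≠ j) :
      Rel n (zz i j h * z i * (1 - z j) + (1 - zz i j h) * (1 - z i) * z j)
  | mixed_bar (i j : Signed n) (h : i ≠ j) (h' : i ≠ bar j) :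
      Rel n (z j * zz i (bar j) h' * (1 - zz i j h) +
        (1 - z j) * (1 - zz i (bar j) h') * zz i j h)
  | antisymm (i j : Signed n) (h : i ≠ j) :
      Rel n (zz i j h - (1 - zz j i h.symm))

/-- The ideal generated by the relations. -/
noncomputable def J (n : ℕ) : Ideal (MvPolynomial (Gen n) ℤ) := Ideal.span {r | Rel n r}

end OrbitConfiguration

/-! ### Cones on singular simplices -/

namespace SingularCone


/-! Every nonzero real is uniquely `s * exp (s * a)` with `s = ±1`. In these coordinates `φ` flips
`s` and fixes `a`, and on each half-line the order is the order of `a`. Hence the conditions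
defining the space say exactly that the coordinates `a_i` are distinct, so the space is `{±1}^n`
times the configurations of distinct reals. A region is given by signs and an ordering of the `a_i`.
It is convex in the coordinates `a`, and the Heaviside functions are constant on it and tell it
apart from the other regions.

Topology: the straight-line contraction of each region turns every singular simplex into a cone, and
the cone is a contracting homotopy of the singular complex. So cohomology vanishes in positive
degrees, and `H^0` is the ring of integer functions on the set of Heaviside values
(`cohomologyEquiv`).

Algebra: modulo the idempotent relations, the polynomial ring is the ring of integer functions on
Boolean vectors, with the indicator polynomials as orthogonal idempotents. A relation whose value at
a vector is a unit kills the indicator of that vector. What remains is the ring of functions on the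
surviving vectors, provided that all relations vanish on them (`exists_equiv`).

Combinatorics: a surviving vector orders the `n` positive points, one from each pair `i`, `bar i`,
totally, and is determined by this order and the signs. Ranks in this order serve as logarithmic
coordinates of a configuration realising it (`mem_range_code`). Both rings are therefore functions
on the same finite set, and each variable corresponds to its Heaviside function. -/

/-- The topological simplex with `k + 1` vertices. -/
abbrev Δ (k : ℕ) : Type := stdSimplex ℝ (Fin (k + 1))

theorem map_apply_of_injective {X Y : Type} [Fintype X] [Fintype Y] {f : X → Y}
    (hf : Function.Injective f) (s : stdSimplex ℝ X) (x : X) : stdSimplex.map f s (f x) = s x := by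
  classical
  rw [stdSimplex.map_coe, FunOnFinite.linearMap_apply_apply]
  rw [Finset.sum_eq_single x] <;> simp +contextual [hf.eq_iff]

theorem map_apply_of_notMem {X Y : Type} [Fintype X] [Fintype Y] {f : X → Y}
    {y : Y} (hy : ∀ x, f x ≠ y) (s : stdSimplex ℝ X) : stdSimplex.map f s y = 0 := by
  classical
  rw [stdSimplex.map_coe, FunOnFinite.linearMap_apply_apply]
  simp [hy]

/-- The point of the cone over a simplex at height `1 - u` above the point `s` of the base. -/
def join {k : ℕ} (q : Δ k × unitInterval) : Δ (k + 1) :=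
  ⟨Fin.cons (1 - (q.2 : ℝ)) fun i => (q.2 : ℝ) * q.1 i, by
    refine ⟨fun i => ?_, ?_⟩
    · refine Fin.cases ?_ (fun i => ?_) i
      · simpa using q.2.2.2
      · simpa using mul_nonneg q.2.2.1 (stdSimplex.zero_le q.1 i)
    · rw [Fin.sum_univ_succ]
      simp [← Finset.mul_sum]⟩

theorem join_zero {k : ℕ} (q : Δ k × unitInterval) : join q 0 = 1 - (q.2 : ℝ) := rfl

theorem join_succ {k : ℕ} (q : Δ k × unitInterval) (i : Fin (k + 1)) :
    join q i.succ = (q.2 : ℝ) * q.1 i := rfl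

theorem continuous_join {k : ℕ} : Continuous (join (k := k)) := by
  refine Continuous.subtype_mk (continuous_pi fun i => ?_) _
  refine Fin.cases ?_ (fun i => ?_) i
  · simp only [Fin.cons_zero]; fun_prop
  · simp only [Fin.cons_succ]
    have : Continuous fun q : Δ k × unitInterval => q.1 i :=
      (continuous_apply i).comp (continuous_subtype_val.comp continuous_fst)
    fun_prop

theorem join_surjective {k : ℕ} : Function.Surjective (join (k := k)) := by
  intro t
  have hs := stdSimplex.sum_eq_one t
  rw [Fin.sum_univ_succ] at hs
  by_cases h : t 0 = 1
  -- At the apex the base point is irrelevant, because `u = 0`.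
  · refine ⟨(Classical.arbitrary _, 0), stdSimplex.ext (funext fun i => ?_)⟩
    have h0 : ∑ i : Fin (k + 1), t i.succ = 0 := by linarith
    rw [Finset.sum_eq_zero_iff_of_nonneg fun i _ => stdSimplex.zero_le t _] at h0
    refine Fin.cases ?_ (fun i => ?_) i
    · simp [join_zero, h]
    · simp [join_succ, h0 i]
  · have h1 : t 0 < 1 := lt_of_le_of_ne (stdSimplex.le_one t 0) h
    have h2 : 1 - t 0 ≠ 0 := by linarith
    refine ⟨(⟨fun i => t i.succ / (1 - t 0), fun i => div_nonneg (stdSimplex.zero_le t _)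
      (by linarith), ?_⟩, ⟨1 - t 0, by linarith, by linarith [stdSimplex.zero_le t 0]⟩),
      stdSimplex.ext (funext fun i => ?_)⟩
    · rw [← Finset.sum_div, div_eq_one_iff_eq h2]
      linarith
    · refine Fin.cases ?_ (fun i => ?_) i
      · simp [join_zero]
      · rw [join_succ]
        exact mul_div_cancel₀ _ h2

theorem isQuotientMap_join {k : ℕ} :
    Topology.IsQuotientMap (⟨join, continuous_join⟩ : C(Δ k × unitInterval, Δ (k + 1))) :=
  continuous_join.isClosedMap.isQuotientMap continuous_join join_surjective

/-- The cone parametrisation makes no identification except collapsing `u = 0` to the apex. -/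
theorem eq_of_join_eq {k : ℕ} {q q' : Δ k × unitInterval} (h : join q = join q') :
    q.2 = q'.2 ∧ (q.2 = 0 ∨ q = q') := by
  have h2 : q.2 = q'.2 := by
    have := DFunLike.congr_fun h 0
    rw [join_zero, join_zero] at this
    exact Subtype.ext (by linarith)
  refine ⟨h2, or_iff_not_imp_left.2 fun h0 => Prod.ext (stdSimplex.ext (funext fun i => ?_)) h2⟩
  have := DFunLike.congr_fun h i.succ
  rw [join_succ, join_succ, ← h2] at this
  exact mul_left_cancel₀ (fun e => h0 (Subtype.ext e)) this

theorem map_succAbove_zero {k : ℕ} (s : Δ k) : stdSimplex.map (Fin.succAbove 0) s = join (s, 1) := by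
  refine stdSimplex.ext (funext fun i => Fin.cases ?_ (fun i => ?_) i)
  · rw [map_apply_of_notMem fun x => Fin.succAbove_ne 0 x]
    simp [join_zero]
  · rw [join_succ, ← Fin.succAbove_zero, map_apply_of_injective Fin.succAbove_right_injective]
    simp

theorem map_succAbove_succ {k : ℕ} (i : Fin (k + 2)) (q : Δ k × unitInterval) :
    stdSimplex.map (Fin.succAbove i.succ) (join q) =
      join (stdSimplex.map (Fin.succAbove i) q.1, q.2) := by
  refine stdSimplex.ext (funext fun j => ?_)
  refine Fin.succAboveCases i.succ ?_ (fun j => ?_) j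
  · rw [map_apply_of_notMem fun x => Fin.succAbove_ne _ x, join_succ,
      map_apply_of_notMem fun x => Fin.succAbove_ne _ x]
    simp
  · rw [map_apply_of_injective Fin.succAbove_right_injective]
    refine Fin.cases ?_ (fun j => ?_) j
    · rw [Fin.succ_succAbove_zero, join_zero, join_zero]
    · rw [Fin.succ_succAbove_succ, join_succ, join_succ,
        map_apply_of_injective Fin.succAbove_right_injective]

/-- A deformation of `X` onto one point in each fibre of a locally constant map `comp : X → ι`. -/
structure FibrewiseContraction (X ι : Type) [TopologicalSpace X] [TopologicalSpace ι] where
  /-- The locally constant map. -/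
  comp : C(X, ι)
  /-- The point to which a fibre is contracted. -/
  base : ι → X
  /-- The deformation. -/
  homotopy : C(X × unitInterval, X)
  homotopy_zero : ∀ x, homotopy (x, 0) = base (comp x)
  homotopy_one : ∀ x, homotopy (x, 1) = x

namespace FibrewiseContraction

variable {X ι : Type} [TopologicalSpace X] [TopologicalSpace ι] [DiscreteTopology ι]
  (C : FibrewiseContraction X ι)

theorem comp_eq {Y : Type} [TopologicalSpace Y] [PreconnectedSpace Y] (f : C(Y, X)) (s t : Y) :
    C.comp (f s) = C.comp (f t) :=
  PreconnectedSpace.constant inferInstance (C.comp.comp f).continuous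

/-- The deformation, applied to a singular simplex. -/
def deform {k : ℕ} (σ : C(Δ k, X)) : C(Δ k × unitInterval, X) :=
  ⟨fun q => C.homotopy (σ q.1, q.2), by fun_prop⟩

/-- At `u = 0` the deformation sends `σ s` to the base point of its fibre, which does not depend on
`s`, since a simplex is connected and `ι` is discrete. -/
theorem factorsThrough_deform {k : ℕ} (σ : C(Δ k, X)) : Function.FactorsThrough (C.deform σ)
    (⟨join, continuous_join⟩ : C(Δ k × unitInterval, Δ (k + 1))) := fun q q' h => by
  obtain ⟨h2, h0 | h0⟩ := eq_of_join_eq h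
  · simp only [deform, ContinuousMap.coe_mk, ← h2, h0, C.homotopy_zero, C.comp_eq σ q.1 q'.1]
  · rw [h0]

/-- The cone on a singular simplex, whose initial vertex is the base point of the fibre. -/
noncomputable def cone {k : ℕ} (σ : C(Δ k, X)) : C(Δ (k + 1), X) :=
  isQuotientMap_join.lift (C.deform σ) (C.factorsThrough_deform σ)

theorem cone_join {k : ℕ} (σ : C(Δ k, X)) (q : Δ k × unitInterval) :
    C.cone σ (join q) = C.homotopy (σ q.1, q.2) :=
  DFunLike.congr_fun (isQuotientMap_join.lift_comp (C.deform σ) (C.factorsThrough_deform σ)) q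

/-- The `i`-th face of a singular simplex. -/
noncomputable def singularFace {k : ℕ} (i : Fin (k + 2)) (σ : C(Δ (k + 1), X)) : C(Δ k, X) :=
  σ.comp ⟨stdSimplex.map (Fin.succAbove i), stdSimplex.continuous_map _⟩

theorem singularFace_zero_cone {k : ℕ} (σ : C(Δ k, X)) : singularFace 0 (C.cone σ) = σ := by
  ext s
  change C.cone σ (stdSimplex.map (Fin.succAbove 0) s) = σ s
  rw [map_succAbove_zero, cone_join, homotopy_one]

/-- With `singularFace_zero_cone` this gives `∂ (cone σ) = σ - cone (∂ σ)` in positive degrees, the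
identity behind the contracting homotopy. -/
theorem singularFace_succ_cone {k : ℕ} (i : Fin (k + 2)) (σ : C(Δ (k + 1), X)) :
    singularFace i.succ (C.cone σ) = C.cone (singularFace i σ) := by
  ext s
  obtain ⟨q, rfl⟩ := join_surjective s
  change C.cone σ (stdSimplex.map (Fin.succAbove i.succ) (join q)) = _
  rw [map_succAbove_succ, cone_join, cone_join]
  rfl

theorem singularFace_one_cone (σ : C(Δ 0, X)) (s t : Δ 0) :
    singularFace 1 (C.cone σ) s = C.base (C.comp (σ t)) := by
  change C.cone σ (stdSimplex.map (Fin.succAbove 1) s) = _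
  have : stdSimplex.map (Fin.succAbove 1) s = join (t, 0) := by
    refine stdSimplex.ext (funext fun i => Fin.succAboveCases 1 ?_ (fun i => ?_) i)
    · rw [map_apply_of_notMem fun x => Fin.succAbove_ne _ x]
      exact (zero_mul (t 0)).symm
    · rw [map_apply_of_injective Fin.succAbove_right_injective, Subsingleton.elim i 0,
        stdSimplex.eq_one_of_unique (X := Fin 1)]
      exact (sub_zero 1).symm
  rw [this, cone_join, homotopy_zero]

end FibrewiseContraction

/-! ### Cohomology of a space that contracts fibrewise -/

open SSetCohomology DirectSum

variable {X : Type} [TopologicalSpace X]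

/-- Singular simplices as continuous maps. -/
noncomputable def simplexEquiv (k : ℕ) : Simplex (TopCat.toSSet.obj (TopCat.of X)) k ≃ C(Δ k, X) :=
  TopCat.toSSetObjEquiv (TopCat.of X) (Opposite.op (SimplexCategory.mk k))

theorem simplexEquiv_δ {k : ℕ} (i : Fin (k + 2))
    (σ : Simplex (TopCat.toSSet.obj (TopCat.of X)) (k + 1)) :
    simplexEquiv k ((TopCat.toSSet.obj (TopCat.of X)).δ i σ) =
      FibrewiseContraction.singularFace i (simplexEquiv (k + 1) σ) := rfl

theorem toSSetObj₀Equiv_eq (σ : Simplex (TopCat.toSSet.obj (TopCat.of X)) 0) (s : Δ 0) :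
    TopCat.toSSetObj₀Equiv (X := TopCat.of X) σ = simplexEquiv 0 σ s := by
  rw [Subsingleton.elim s default]
  rfl

namespace FibrewiseContraction

variable {ι : Type} [TopologicalSpace ι] [DiscreteTopology ι] (C : FibrewiseContraction X ι)

theorem mem_B_of_mem_Z (C : FibrewiseContraction X ι) {k : ℕ}
    {f : Cochain (TopCat.toSSet.obj (TopCat.of X)) (k + 1)}
    (hf : f ∈ Z _ (k + 1)) : f ∈ B _ (k + 1) := by
  -- The primitive is `f` evaluated on cones; `d f = 0` on the cone over `σ` says that its
  -- coboundary is `f`.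
  refine ⟨fun σ => f ((simplexEquiv (k + 1)).symm (C.cone (simplexEquiv k σ))), funext fun σ => ?_⟩
  have h := congrFun (show d _ _ f = 0 from hf)
    ((simplexEquiv (k + 2)).symm (C.cone (simplexEquiv (k + 1) σ)))
  rw [d_apply, Fin.sum_univ_succ] at h
  have h0 : (TopCat.toSSet.obj (TopCat.of X)).δ 0
      ((simplexEquiv (k + 2)).symm (C.cone (simplexEquiv (k + 1) σ))) = σ := by
    apply (simplexEquiv (k + 1)).injective
    rw [simplexEquiv_δ, Equiv.apply_symm_apply, singularFace_zero_cone]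
  have h1 : ∀ i : Fin (k + 2), (TopCat.toSSet.obj (TopCat.of X)).δ i.succ
      ((simplexEquiv (k + 2)).symm (C.cone (simplexEquiv (k + 1) σ))) =
      (simplexEquiv (k + 1)).symm
        (C.cone (simplexEquiv k ((TopCat.toSSet.obj (TopCat.of X)).δ i σ))) := fun i => by
    apply (simplexEquiv (k + 1)).injective
    rw [simplexEquiv_δ, Equiv.apply_symm_apply, Equiv.apply_symm_apply, simplexEquiv_δ,
      singularFace_succ_cone]
  simp only [h0, h1, Fin.val_succ, pow_succ, Fin.val_zero, pow_zero, one_mul, mul_neg, mul_one,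
    neg_mul, Finset.sum_neg_distrib, Pi.zero_apply] at h
  rw [d_apply]
  linarith

/-- The cone over a point is a path joining it to the base point of its fibre, and a `0`-cocycle has
equal values at the ends of a path. -/
theorem cocycle_apply (f : Z (TopCat.toSSet.obj (TopCat.of X)) 0)
    (σ : Simplex (TopCat.toSSet.obj (TopCat.of X)) 0) :
    f.1 σ = f.1 ((TopCat.toSSetObj₀Equiv (X := TopCat.of X)).symm
      (C.base (C.comp (TopCat.toSSetObj₀Equiv (X := TopCat.of X) σ)))) := by
  have h := congrFun (show d _ _ f.1 = 0 from f.2)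
    ((simplexEquiv 1).symm (C.cone (simplexEquiv 0 σ)))
  have h0 : (TopCat.toSSet.obj (TopCat.of X)).δ 0
      ((simplexEquiv 1).symm (C.cone (simplexEquiv 0 σ))) = σ := by
    apply (simplexEquiv 0).injective
    rw [simplexEquiv_δ, Equiv.apply_symm_apply, singularFace_zero_cone]
  have h1 : (TopCat.toSSet.obj (TopCat.of X)).δ 1
      ((simplexEquiv 1).symm (C.cone (simplexEquiv 0 σ))) =
      (TopCat.toSSetObj₀Equiv (X := TopCat.of X)).symm
      (C.base (C.comp (TopCat.toSSetObj₀Equiv (X := TopCat.of X) σ))) := by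
    apply (TopCat.toSSetObj₀Equiv (X := TopCat.of X)).injective
    rw [toSSetObj₀Equiv_eq _ default, simplexEquiv_δ, Equiv.apply_symm_apply,
      Equiv.apply_symm_apply, C.singularFace_one_cone _ _ default, toSSetObj₀Equiv_eq _ default]
  rw [d_apply, Fin.sum_univ_two, h0, h1] at h
  simp only [Fin.val_zero, pow_zero, one_mul, Fin.val_one, pow_one, neg_mul, Pi.zero_apply] at h
  linarith

/-- The `0`-cocycle of a function that is constant on the fibres. -/
noncomputable def cocycle (f : ι → ℤ) : Z (TopCat.toSSet.obj (TopCat.of X)) 0 :=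
  ⟨fun σ => f (C.comp (TopCat.toSSetObj₀Equiv (X := TopCat.of X) σ)), by
    change d _ 0 _ = 0
    funext σ
    rw [d_apply, Fin.sum_univ_two]
    simp only [toSSetObj₀Equiv_eq _ default, simplexEquiv_δ]
    have := C.comp_eq (simplexEquiv 1 σ)
      (stdSimplex.map (Fin.succAbove 0) default) (stdSimplex.map (Fin.succAbove 1) default)
    change (-1 : ℤ) ^ 0 * f (C.comp (simplexEquiv 1 σ (stdSimplex.map (Fin.succAbove 0) default))) +
      (-1 : ℤ) ^ 1 * f (C.comp (simplexEquiv 1 σ (stdSimplex.map (Fin.succAbove 1) default))) = 0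
    rw [this]
    ring⟩

theorem cocycle_symm (f : ι → ℤ) (x : X) :
    (C.cocycle f).1 ((TopCat.toSSetObj₀Equiv (X := TopCat.of X)).symm x) = f (C.comp x) := by
  change f (C.comp (TopCat.toSSetObj₀Equiv (X := TopCat.of X)
    ((TopCat.toSSetObj₀Equiv (X := TopCat.of X)).symm x))) = _
  rw [Equiv.apply_symm_apply]

/-- Functions on the set of fibres, as singular cohomology classes. -/
noncomputable def toCohomology : (ι → ℤ) →+* SingularCohomology X :=
  (DirectSum.ofZeroRingHom (H (TopCat.toSSet.obj (TopCat.of X)))).comp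
    { toFun := fun f => cls (C.cocycle f)
      map_one' := rfl
      map_mul' := fun f g => by
        change _ = cls (cupZ (C.cocycle f) (C.cocycle g))
        congr 1
        ext σ
        change _ = (C.cocycle f).1 (face 0 0 _ σ) * (C.cocycle g).1 (face 0 0 _ σ)
        rw [face_self]
        rfl
      map_zero' := by rw [show C.cocycle 0 = 0 from rfl, map_zero]
      map_add' := fun f g => by
        rw [show C.cocycle (f + g) = C.cocycle f + C.cocycle g from rfl, map_add] }

theorem toCohomology_apply (f : ι → ℤ) : C.toCohomology f =
    DirectSum.of (H (TopCat.toSSet.obj (TopCat.of X))) 0 (cls (C.cocycle f)) := rfl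

theorem isClassOf_toCohomology (f : ι → ℤ) : IsClassOf (fun x => f (C.comp x)) (C.toCohomology f) :=
  ⟨C.cocycle f, C.cocycle_symm f, rfl⟩

theorem toCohomology_injective (hC : Function.Surjective C.comp) :
    Function.Injective C.toCohomology := by
  intro f g h
  have h1 := DirectSum.of_injective _ h
  have h2 := (QuotientAddGroup.eq (s := BZ _ 0)).1 h1
  have h3 : (-(C.cocycle f) + C.cocycle g).1 = 0 := h2
  funext i
  obtain ⟨x, rfl⟩ := hC i
  have h4 := congrFun h3 ((TopCat.toSSetObj₀Equiv (X := TopCat.of X)).symm x)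
  change -(C.cocycle f).1 _ + (C.cocycle g).1 _ = 0 at h4
  rw [cocycle_symm, cocycle_symm] at h4
  linarith

theorem toCohomology_surjective : Function.Surjective C.toCohomology := by
  intro a
  induction a using DirectSum.induction_on with
  | zero => exact ⟨0, map_zero _⟩
  | of k a =>
    obtain ⟨f, rfl⟩ := cls_surjective a
    cases k with
    | zero =>
      refine ⟨fun i => f.1 ((TopCat.toSSetObj₀Equiv (X := TopCat.of X)).symm (C.base i)), ?_⟩
      rw [toCohomology_apply]
      congr 2
      ext σ
      exact (C.cocycle_apply f σ).symm
    | succ k => exact ⟨0, by rw [map_zero, cls_eq_zero (C.mem_B_of_mem_Z f.2), map_zero]⟩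
  | add a b ha hb =>
    obtain ⟨f, rfl⟩ := ha
    obtain ⟨g, rfl⟩ := hb
    exact ⟨f + g, map_add _ _ _⟩

/-- The cohomology ring of a space with contractible fibres over a discrete space. -/
noncomputable def cohomologyEquiv (hC : Function.Surjective C.comp) :
    (ι → ℤ) ≃+* SingularCohomology X :=
  RingEquiv.ofBijective C.toCohomology ⟨C.toCohomology_injective hC, C.toCohomology_surjective⟩

end FibrewiseContraction

end SingularCone

/-! ### Quotients of polynomial rings generated by idempotents -/

namespace BooleanQuotient

open MvPolynomial

variable {σ : Type}

/-- The integral point with coordinates `0` and `1` of a Boolean vector. -/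
def toPoint (v : σ → Bool) (g : σ) : ℤ := if v g then 1 else 0

/-- Evaluation at a set of Boolean vectors. -/
noncomputable def evalOn (T : Set (σ → Bool)) : MvPolynomial σ ℤ →+* (T → ℤ) :=
  RingHom.pi fun v => eval (toPoint v.1)

theorem evalOn_apply (T : Set (σ → Bool)) (p : MvPolynomial σ ℤ) (v : T) :
    evalOn T p v = eval (toPoint v.1) p := rfl

variable [Fintype σ]

/-- The polynomial taking the value `1` at `v`, and `0` at all other Boolean vectors. -/
noncomputable def indicator (v : σ → Bool) : MvPolynomial σ ℤ :=
  ∏ g, if v g then X g else 1 - X g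

/-- Expand the product over `g` of `X g + (1 - X g) = 1`. -/
theorem sum_indicator [DecidableEq σ] :
    ∑ v : σ → Bool, indicator v = (1 : MvPolynomial σ ℤ) := by
  have h := Finset.prod_univ_sum (fun _ : σ => (Finset.univ : Finset Bool))
    fun g b => if b then X g else 1 - (X g : MvPolynomial σ ℤ)
  rw [Fintype.piFinset_univ] at h
  rw [show ∑ v : σ → Bool, indicator v = _ from h.symm]
  simp

theorem eval_indicator [DecidableEq σ] (v w : σ → Bool) :
    eval (toPoint v) (indicator w) = if v = w then 1 else 0 := by
  rw [indicator, map_prod]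
  split_ifs with h
  · subst h
    refine Finset.prod_eq_one fun g _ => ?_
    cases h : v g <;> simp [toPoint, h]
  · obtain ⟨g, hg⟩ := Function.ne_iff.1 h
    refine Finset.prod_eq_zero (Finset.mem_univ g) ?_
    cases hv : v g <;> cases hw : w g <;> simp_all [toPoint]

variable {J : Ideal (MvPolynomial σ ℤ)}

/-- Multiplying `X g - C (toPoint v g)` by the factor of the indicator at `g` gives `X g * (1 - X
g)` up to sign. -/
theorem mk_X_mul_indicator (hJ : ∀ g, X g * (1 - X g) ∈ J) (v : σ → Bool) (g : σ) :
    Ideal.Quotient.mk J (X g * indicator v) =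
      Ideal.Quotient.mk J (C (toPoint v g) * indicator v) := by
  classical
  rw [Ideal.Quotient.eq, ← sub_mul, indicator, ← Finset.mul_prod_erase _ _ (Finset.mem_univ g),
    ← mul_assoc]
  refine Ideal.mul_mem_right _ _ ?_
  cases h : v g
  · simpa [toPoint, h] using hJ g
  · have := J.neg_mem (hJ g)
    simp only [toPoint, h, if_true, map_one]
    convert this using 1
    ring

theorem mk_mul_indicator (hJ : ∀ g, X g * (1 - X g) ∈ J) (v : σ → Bool) (p : MvPolynomial σ ℤ) :
    Ideal.Quotient.mk J (p * indicator v) =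
      Ideal.Quotient.mk J (C (eval (toPoint v) p) * indicator v) := by
  induction p using MvPolynomial.induction_on with
  | C a => rw [eval_C]
  | add p q hp hq => rw [add_mul, map_add, hp, hq, map_add, C_add, add_mul, map_add]
  | mul_X p g hp =>
    rw [mul_assoc, map_mul, mk_X_mul_indicator hJ, ← map_mul, mul_left_comm, map_mul, hp,
      ← map_mul, map_mul (eval _), eval_X, C_mul]
    congr 1
    ring

theorem evalOn_surjective (T : Set (σ → Bool)) : Function.Surjective (evalOn T) := by
  classical
  intro f
  refine ⟨∑ w : T, C (f w) * indicator w.1, funext fun v => ?_⟩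
  rw [evalOn_apply, map_sum, Finset.sum_eq_single v]
  · simp [eval_indicator]
  · intro w _ hw
    simp [eval_indicator, Subtype.coe_inj, hw.symm]
  · simp

/-- A quotient by relations that make the variables idempotent is the ring of functions on the
Boolean solutions, if every other Boolean vector makes some relation a unit. -/
theorem exists_equiv {S : Set (MvPolynomial σ ℤ)} {T : Set (σ → Bool)}
    (hS : ∀ g, X g * (1 - X g) ∈ Ideal.span S)
    (hT : ∀ v ∈ T, ∀ r ∈ S, eval (toPoint v) r = 0)
    (hT' : ∀ v ∉ T, ∃ r ∈ S, IsUnit (eval (toPoint v) r)) :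
    ∃ e : (MvPolynomial σ ℤ ⧸ Ideal.span S) ≃+* (T → ℤ),
      ∀ p, e (Ideal.Quotient.mk _ p) = evalOn T p := by
  classical
  have hker : ∀ p ∈ Ideal.span S, evalOn T p = 0 := fun p hp => by
    have : Ideal.span S ≤ RingHom.ker (evalOn T) :=
      Ideal.span_le.2 fun r hr => funext fun v => hT v.1 v.2 r hr
    exact this hp
  refine ⟨RingEquiv.ofBijective (Ideal.Quotient.lift _ (evalOn T) hker) ⟨?_, ?_⟩, fun p => rfl⟩
  · rw [injective_iff_map_eq_zero]
    intro a ha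
    obtain ⟨p, rfl⟩ := Ideal.Quotient.mk_surjective a
    rw [Ideal.Quotient.lift_mk] at ha
    -- Modulo the ideal, `p` is the sum of its values `p(v)` times the indicators: on `T` the values
    -- vanish, and off `T` the indicators do.
    rw [← mul_one p, ← sum_indicator, Finset.mul_sum, map_sum]
    refine Finset.sum_eq_zero fun v _ => ?_
    rw [mk_mul_indicator hS]
    by_cases hv : v ∈ T
    · have := congrFun ha ⟨v, hv⟩
      rw [evalOn_apply] at this
      simp [this]
    · obtain ⟨r, hr, hu⟩ := hT' v hv
      have h0 : Ideal.Quotient.mk (Ideal.span S) (r * indicator v) = 0 :=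
        Ideal.Quotient.eq_zero_iff_mem.2 (Ideal.mul_mem_right _ _ (Ideal.subset_span hr))
      rw [mk_mul_indicator hS, map_mul] at h0
      have hu' := (hu.map (C (σ := σ))).map (Ideal.Quotient.mk (Ideal.span S))
      rw [map_mul, (hu'.mul_right_eq_zero).1 h0, mul_zero]
  · exact Ideal.Quotient.lift_surjective_of_surjective _ _ (evalOn_surjective T)

end BooleanQuotient

/-! ### Components of the orbit configuration space -/

namespace OrbitConfiguration

/-- The nonzero real number with sign `s` and logarithmic coordinate `a`. -/
noncomputable def place (s a : ℝ) : ℝ := s * Real.exp (s * a)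

/-- The sign of a nonzero real number. -/
noncomputable def sgn (x : ℝ) : ℝ := x / |x|

/-- The logarithmic coordinate of a nonzero real number; it is invariant under `phi`. -/
noncomputable def logCoord (x : ℝ) : ℝ := sgn x * Real.log x

theorem sgn_of_pos {x : ℝ} (h : 0 < x) : sgn x = 1 := by
  rw [sgn, abs_of_pos h, div_self h.ne']

theorem sgn_of_neg {x : ℝ} (h : x < 0) : sgn x = -1 := by
  rw [sgn, abs_of_neg h, div_neg, div_self h.ne]

theorem sgn_eq_or {x : ℝ} (h : x ≠ 0) : sgn x = 1 ∨ sgn x = -1 :=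
  h.lt_or_gt.symm.imp sgn_of_pos sgn_of_neg

theorem place_one (a : ℝ) : place 1 a = Real.exp a := by simp [place]

theorem place_neg_one (a : ℝ) : place (-1) a = -Real.exp (-a) := by simp [place]

theorem place_pos_iff {s a : ℝ} (hs : s = 1 ∨ s = -1) : 0 < place s a ↔ s = 1 := by
  rcases hs with rfl | rfl
  · simp [place_one, Real.exp_pos]
  · have := Real.exp_pos (-a)
    rw [place_neg_one]
    constructor <;> intro h <;> linarith

theorem place_ne_zero {s a : ℝ} (hs : s = 1 ∨ s = -1) : place s a ≠ 0 := by
  rcases hs with rfl | rfl <;> simp [place, Real.exp_ne_zero]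

/-- The sign inside the exponent makes the negative branch `a ↦ -exp (-a)` increasing as well. -/
theorem place_lt_place_iff {s a b : ℝ} (hs : s = 1 ∨ s = -1) :
    place s a < place s b ↔ a < b := by
  rcases hs with rfl | rfl
  · simp [place_one]
  · simp [place_neg_one]

theorem place_ne_place {s t a b : ℝ} (hs : s = 1 ∨ s = -1) (ht : t = 1 ∨ t = -1) (h : a ≠ b) :
    place s a ≠ place t b := by
  intro e
  have hst : s = t := by
    have := place_pos_iff (a := a) hs
    rw [e, place_pos_iff ht] at this
    rcases hs with rfl | rfl <;> rcases ht with rfl | rfl <;>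
      first | rfl | (exfalso; norm_num at this)
  subst hst
  rcases h.lt_or_gt with h | h
  · exact ((place_lt_place_iff hs).2 h).ne e
  · exact ((place_lt_place_iff hs).2 h).ne' e

/-- Since `φ(x) = -1/x`, both the outer sign and the exponent change sign, which amounts to `s ↦ -s`
with `a` fixed. -/
theorem phi_place {s a : ℝ} (hs : s = 1 ∨ s = -1) : phi (place s a) = place (-s) a := by
  rw [phi, sq_abs]
  rcases hs with rfl | rfl
  · have := Real.exp_ne_zero a
    rw [place_one, place_neg_one, Real.exp_neg]
    field_simp
  · have := Real.exp_ne_zero a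
    rw [neg_neg, place_one, place_neg_one, Real.exp_neg]
    field_simp

theorem place_sgn_logCoord {x : ℝ} (h : x ≠ 0) : place (sgn x) (logCoord x) = x := by
  rcases h.lt_or_gt with h | h
  · rw [logCoord, sgn_of_neg h, place_neg_one, neg_one_mul, neg_neg,
      ← Real.log_neg_eq_log, Real.exp_log (neg_pos.2 h), neg_neg]
  · rw [logCoord, sgn_of_pos h, place_one, one_mul, Real.exp_log h]

/-! ### Configurations in sign and logarithmic coordinates -/

variable {n : ℕ}

/-- The configuration with given signs and distinct logarithmic coordinates. -/
noncomputable def ofCoords (s a : Fin n → ℝ) (hs : ∀ i, s i = 1 ∨ s i = -1)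
    (ha : Function.Injective a) : ZSpace n :=
  ⟨fun i => place (s i) (a i), fun i => place_ne_zero (hs i), fun i j h =>
    ⟨place_ne_place (hs i) (hs j) (ha.ne h), by
      rw [phi_place (hs j)]
      exact place_ne_place (hs i) (by rcases hs j with h | h <;> simp [h]) (ha.ne h)⟩⟩

/-- Equal logarithmic coordinates would give `x_i = x_j` if the signs agree and `x_i = φ(x_j)` if
they differ. -/
theorem logCoord_injective (x : ZSpace n) : Function.Injective fun i => logCoord (x.1 i) := by
  intro i j h
  by_contra hij
  obtain ⟨h1, h2⟩ := x.2.2 i j hij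
  have hi := x.2.1 i
  have hj := x.2.1 j
  rw [← place_sgn_logCoord hi, ← place_sgn_logCoord hj] at h1 h2
  rw [phi_place (sgn_eq_or hj)] at h2
  simp only at h
  rw [h] at h1 h2
  rcases sgn_eq_or hi with e | e <;> rcases sgn_eq_or hj with e' | e' <;> simp [e, e'] at h1 h2

/-- The sign of the point with a given signed index. -/
noncomputable def pointSgn (x : ZSpace n) : Signed n → ℝ
  | Sum.inl i => sgn (x.1 i)
  | Sum.inr i => -sgn (x.1 i)

/-- The logarithmic coordinate of the point with a given signed index. -/
noncomputable def pointLog (x : ZSpace n) : Signed n → ℝ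
  | Sum.inl i => logCoord (x.1 i)
  | Sum.inr i => logCoord (x.1 i)

theorem pointSgn_eq_or (x : ZSpace n) (i : Signed n) : pointSgn x i = 1 ∨ pointSgn x i = -1 := by
  rcases i with i | i <;> rcases sgn_eq_or (x.2.1 i) with e | e <;> simp [pointSgn, e]

theorem point_eq (x : ZSpace n) (i : Signed n) : point x i = place (pointSgn x i) (pointLog x i) := by
  rcases i with i | i
  · exact (place_sgn_logCoord (x.2.1 i)).symm
  · rw [point, pointSgn, pointLog, ← phi_place (sgn_eq_or (x.2.1 i)),
      place_sgn_logCoord (x.2.1 i)]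

theorem pointSgn_bar (x : ZSpace n) (i : Signed n) : pointSgn x (bar i) = -pointSgn x i := by
  rcases i with i | i <;> simp [bar, pointSgn]

theorem pointLog_bar (x : ZSpace n) (i : Signed n) : pointLog x (bar i) = pointLog x i := by
  rcases i with i | i <;> rfl

theorem point_ne_zero (x : ZSpace n) (i : Signed n) : point x i ≠ 0 := by
  rw [point_eq]
  exact place_ne_zero (pointSgn_eq_or x i)

theorem point_pos_iff (x : ZSpace n) (i : Signed n) : 0 < point x i ↔ pointSgn x i = 1 := by
  rw [point_eq, place_pos_iff (pointSgn_eq_or x i)]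

theorem point_bar_pos_iff (x : ZSpace n) (i : Signed n) :
    0 < point x (bar i) ↔ ¬ 0 < point x i := by
  rw [point_pos_iff, point_pos_iff, pointSgn_bar]
  rcases pointSgn_eq_or x i with e | e <;> rw [e] <;> norm_num

theorem point_injective (x : ZSpace n) : Function.Injective (point x) := by
  intro i j h
  by_contra hij
  have hs : pointSgn x i = pointSgn x j := by
    have := point_pos_iff x i
    rw [h, point_pos_iff] at this
    rcases pointSgn_eq_or x i with e | e <;> rcases pointSgn_eq_or x j with e' | e' <;>
      rw [e, e'] at this ⊢ <;> norm_num at this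
  have hl : pointLog x i ≠ pointLog x j := fun hl => by
    have e : ∀ k l : Fin n, logCoord (x.1 k) = logCoord (x.1 l) → k = l :=
      fun k l h => logCoord_injective x h
    have hne : ∀ k, sgn (x.1 k) ≠ -sgn (x.1 k) := fun k => by
      rcases sgn_eq_or (x.2.1 k) with e | e <;> rw [e] <;> norm_num
    rcases i with i | i <;> rcases j with j | j <;> obtain rfl := e _ _ hl
    · exact hij rfl
    · exact hne i hs
    · exact hne i hs.symm
    · exact hij rfl
  rw [point_eq, point_eq] at h
  exact place_ne_place (pointSgn_eq_or x i) (pointSgn_eq_or x j) hl h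

theorem point_lt_iff (x : ZSpace n) {i j : Signed n} (h : pointSgn x i = pointSgn x j) :
    point x i < point x j ↔ pointLog x i < pointLog x j := by
  rw [point_eq, point_eq, h, place_lt_place_iff (pointSgn_eq_or x j)]

theorem pointSgn_eq_of_pos_iff {x y : ZSpace n} {i j : Signed n}
    (h : 0 < point x i ↔ 0 < point y j) : pointSgn x i = pointSgn y j := by
  rw [point_pos_iff, point_pos_iff] at h
  rcases pointSgn_eq_or x i with e | e <;> rcases pointSgn_eq_or y j with e' | e' <;>
    rw [e, e'] at h ⊢ <;> norm_num at h

/-- `φ` is increasing on each half-line, as it preserves logarithmic coordinates. -/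
theorem point_bar_lt_bar_iff (x : ZSpace n) {i j : Signed n}
    (h : 0 < point x i ↔ 0 < point x j) :
    point x (bar i) < point x (bar j) ↔ point x i < point x j := by
  have h' := pointSgn_eq_of_pos_iff h
  rw [point_lt_iff x h', point_lt_iff x (by rw [pointSgn_bar, pointSgn_bar, h']), pointLog_bar,
    pointLog_bar]

/-! ### Local constancy of the Heaviside values -/

theorem continuousOn_phi : ContinuousOn phi {0}ᶜ := by
  refine ContinuousOn.div (by fun_prop) (by fun_prop) fun x hx => ?_
  simpa using hx

theorem continuous_coord (i : Fin n) : Continuous fun x : ZSpace n => x.1 i :=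
  (continuous_apply i).comp continuous_subtype_val

theorem continuous_point (i : Signed n) : Continuous fun x : ZSpace n => point x i := by
  rcases i with i | i
  · exact continuous_coord i
  · exact continuousOn_phi.comp_continuous (continuous_coord i) fun x => x.2.1 i

theorem continuous_sgn (i : Fin n) : Continuous fun x : ZSpace n => sgn (x.1 i) :=
  (continuous_coord i).div (continuous_coord i).abs fun x => abs_ne_zero.2 (x.2.1 i)

theorem continuous_logCoord (i : Fin n) : Continuous fun x : ZSpace n => logCoord (x.1 i) :=
  (continuous_sgn i).mul ((continuous_coord i).log fun x => x.2.1 i)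

open Classical in
/-- The values of the Heaviside functions at a configuration. -/
noncomputable def code (x : ZSpace n) : Gen n → Bool
  | Gen.pair i j _ => decide (point x i < point x j)
  | Gen.single i => decide (0 < point x i)

theorem code_pair (x : ZSpace n) {i j : Signed n} (h : i ≠ j) :
    code x (Gen.pair i j h) = true ↔ point x i < point x j := decide_eq_true_iff

theorem code_single (x : ZSpace n) (i : Signed n) :
    code x (Gen.single i) = true ↔ 0 < point x i := decide_eq_true_iff

/-- As `f` and `g` never agree, `f < g` and `f ≤ g` define the same set, which is thus clopen. -/
theorem continuous_decide {X : Type} [TopologicalSpace X] {f g : X → ℝ} (hf : Continuous f)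
    (hg : Continuous g) (h : ∀ x, f x ≠ g x) {c : X → Bool} (hc : ∀ x, c x = true ↔ f x < g x) :
    Continuous c := by
  rw [continuous_bool_rng true]
  have e : c ⁻¹' {true} = {x | f x < g x} := Set.ext hc
  have e' : {x | f x < g x} = {x | f x ≤ g x} := by
    ext x
    exact ⟨fun hx => (show f x < g x from hx).le, fun hx => lt_of_le_of_ne hx (h x)⟩
  rw [e]
  exact ⟨by rw [e']; exact isClosed_le hf hg, isOpen_lt hf hg⟩

theorem continuous_code : Continuous (code (n := n)) := by
  refine continuous_pi fun g => ?_
  rcases g with ⟨i, j, h⟩ | i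
  · exact continuous_decide (continuous_point i) (continuous_point j)
      (fun x => (point_injective x).ne h) fun x => code_pair x h
  · exact continuous_decide continuous_const (continuous_point i)
      (fun x => (point_ne_zero x i).symm) fun x => code_single x i

/-- Finiteness makes `Gen n → Bool` discrete and allows products over all generators. -/
instance : Finite (Gen n) := by
  refine Finite.of_injective (β := Option (Signed n) × Signed n)
    (fun | Gen.pair i j _ => (some i, j) | Gen.single i => (none, i)) ?_
  rintro (⟨i, j, h⟩ | i) (⟨i', j', h'⟩ | i') e <;> simp_all

/-! ### Convexity of the regions and their contraction -/

theorem sgn_eq_of_code_eq {x y : ZSpace n} (h : code x = code y) (i : Fin n) :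
    sgn (x.1 i) = sgn (y.1 i) := by
  refine pointSgn_eq_of_pos_iff (i := Sum.inl i) (j := Sum.inl i) ?_
  rw [← code_single, h, code_single]

/-- If the signs of `x_i` and `x_j` agree, their Heaviside function compares the logarithmic
coordinates. Otherwise `x_i` is compared with `φ(x_j)`, which has the sign of `x_i` and the
logarithmic coordinate of `x_j`. -/
theorem logCoord_lt_of_code_eq {x y : ZSpace n} (h : code x = code y) {i j : Fin n}
    (hij : logCoord (x.1 i) < logCoord (x.1 j)) : logCoord (y.1 i) < logCoord (y.1 j) := by
  have hne : i ≠ j := by rintro rfl; exact lt_irrefl _ hij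
  have key : ∀ k l : Signed n, (hkl : k ≠ l) → pointSgn x k = pointSgn x l →
      pointSgn y k = pointSgn y l → pointLog x k < pointLog x l → pointLog y k < pointLog y l := by
    intro k l hkl hx hy hlt
    rwa [← point_lt_iff y hy, ← code_pair y hkl, ← h, code_pair, point_lt_iff x hx]
  have hi := sgn_eq_of_code_eq h i
  have hj := sgn_eq_of_code_eq h j
  by_cases hs : sgn (x.1 i) = sgn (x.1 j)
  · exact key (Sum.inl i) (Sum.inl j) (by simpa using hne) hs (by simpa [pointSgn, ← hi, ← hj])
      hij
  · have hs' : sgn (x.1 i) = -sgn (x.1 j) := by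
      rcases sgn_eq_or (x.2.1 i) with e | e <;> rcases sgn_eq_or (x.2.1 j) with e' | e' <;>
        rw [e, e'] at hs ⊢ <;> first | exact absurd rfl hs | norm_num
    exact key (Sum.inl i) (Sum.inr j) (by simp) hs' (by simpa [pointSgn, ← hi, ← hj]) hij

/-- The two configurations order their logarithmic coordinates identically, and convex combinations
preserve a common strict order. -/
theorem lerp_injective {x y : ZSpace n} (h : code x = code y) (u : unitInterval) :
    Function.Injective fun i =>
      (u : ℝ) * logCoord (x.1 i) + (1 - (u : ℝ)) * logCoord (y.1 i) := by
  have key : ∀ i j, logCoord (x.1 i) < logCoord (x.1 j) →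
      (u : ℝ) * logCoord (x.1 i) + (1 - (u : ℝ)) * logCoord (y.1 i) <
        (u : ℝ) * logCoord (x.1 j) + (1 - (u : ℝ)) * logCoord (y.1 j) := by
    intro i j hx
    have hy := logCoord_lt_of_code_eq h hx
    rcases u.2.1.eq_or_lt with h0 | h0
    · simpa [← h0] using hy
    · exact add_lt_add_of_lt_of_le (mul_lt_mul_of_pos_left hx h0)
        (mul_le_mul_of_nonneg_left hy.le (by linarith [u.2.2]))
  intro i j hij
  by_contra hne
  rcases ((logCoord_injective x).ne hne).lt_or_gt with hlt | hlt
  · exact (key i j hlt).ne hij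
  · exact (key j i hlt).ne' hij

/-- A configuration with given values of the Heaviside functions. -/
noncomputable def basePoint (v : Set.range (code (n := n))) : ZSpace n := v.2.choose

theorem code_basePoint (v : Set.range (code (n := n))) : code (basePoint v) = v.1 :=
  v.2.choose_spec

/-- The values of the Heaviside functions, as a point of the set of all such values. -/
noncomputable def component : C(ZSpace n, Set.range (code (n := n))) :=
  ⟨Set.rangeFactorization code, continuous_code.subtype_mk _⟩

theorem component_surjective : Function.Surjective (component (n := n)) :=
  Set.rangeFactorization_surjective

theorem code_eq_basePoint (x : ZSpace n) : code x = code (basePoint (component x)) :=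
  (code_basePoint (component x)).symm

/-- Each region of constant Heaviside values is contracted linearly in logarithmic coordinates. -/
noncomputable def contraction :
    SingularCone.FibrewiseContraction (ZSpace n) (Set.range (code (n := n))) where
  comp := component
  base := basePoint
  homotopy := ⟨fun q => ofCoords (fun i => sgn (q.1.1 i)) _ (fun i => sgn_eq_or (q.1.2.1 i))
      (lerp_injective (code_eq_basePoint q.1) q.2), by
    refine Continuous.subtype_mk (continuous_pi fun i => ?_) _
    have h1 : Continuous fun q : ZSpace n × unitInterval => sgn (q.1.1 i) :=
      (continuous_sgn i).comp continuous_fst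
    have h2 : Continuous fun q : ZSpace n × unitInterval => logCoord (q.1.1 i) :=
      (continuous_logCoord i).comp continuous_fst
    -- The base point jumps between regions, but it is a function on a discrete set.
    have h3 : Continuous fun q : ZSpace n × unitInterval =>
        logCoord ((basePoint (component q.1)).1 i) :=
      (continuous_of_discreteTopology (f := fun v => logCoord ((basePoint v).1 i))).comp
        (component.continuous.comp continuous_fst)
    unfold place
    fun_prop⟩
  homotopy_zero x := by
    refine Subtype.ext (funext fun i => ?_)
    simp only [ContinuousMap.coe_mk, ofCoords, Set.Icc.coe_zero, zero_mul, sub_zero, one_mul,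
      zero_add]
    rw [sgn_eq_of_code_eq (code_eq_basePoint x), place_sgn_logCoord ((basePoint _).2.1 i)]
  homotopy_one x := by
    refine Subtype.ext (funext fun i => ?_)
    simp only [ContinuousMap.coe_mk, ofCoords, Set.Icc.coe_one, one_mul, sub_self, zero_mul,
      add_zero]
    exact place_sgn_logCoord (x.2.1 i)

end OrbitConfiguration

/-! ### Combinatorics of the Heaviside relations -/

namespace OrbitConfiguration

open MvPolynomial BooleanQuotient

variable {n : ℕ}

/-- A Boolean vector is compatible with the relations if none of them becomes a unit. -/
def Compatible (v : Gen n → Bool) : Prop := ∀ r, Rel n r → ¬ IsUnit (eval (toPoint v) r)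

theorem eval_code (x : ZSpace n) {r : MvPolynomial (Gen n) ℤ} (hr : Rel n r) :
    eval (toPoint (code x)) r = 0 := by
  have hp : ∀ i j (h : i ≠ j), toPoint (code x) (Gen.pair i j h) =
      heavisidePair i j x := fun i j h => by
    simp only [toPoint, code_pair, heavisidePair]
  have hs : ∀ i, toPoint (code x) (Gen.single i) = heavisideSingle i x := fun i => by
    simp only [toPoint, code_single, heavisideSingle]
  rcases hr with ⟨i, j, h⟩ | i | ⟨i, j, h⟩ | i | ⟨i, j, k, hij, hjk, hik⟩ | ⟨i, j, h⟩ |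
    ⟨i, j, h, h'⟩ | ⟨i, j, h⟩ <;>
  simp only [map_mul, map_sub, map_add, map_one, eval_X, hp, hs, heavisidePair, heavisideSingle]
  · split_ifs <;> norm_num
  · split_ifs <;> norm_num
  -- For equal signs the two pair terms agree since `φ` is increasing there; for opposite signs all
  -- four values are dictated by the signs.
  · by_cases e : 0 < point x i ↔ 0 < point x j
    · simp only [e, point_bar_lt_bar_iff x e]
      ring
    · have h1 := point_bar_pos_iff x i
      have h2 := point_bar_pos_iff x j
      split_ifs <;> first | (norm_num; done) | grind
  · have h1 := point_bar_pos_iff x i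
    split_ifs <;> first | (norm_num; done) | grind
  · have h1 := (point_injective x).ne hij
    have h2 := (point_injective x).ne hjk
    have h3 := (point_injective x).ne hik
    split_ifs <;> first | (norm_num; done) | grind
  · split_ifs <;> first | (norm_num; done) | grind
  · have h1 := point_bar_pos_iff x j
    have h2 := (point_injective x).ne h
    have h3 := (point_injective x).ne h'
    have h4 := point_ne_zero x (bar j)
    split_ifs <;> first | (norm_num; done) | grind
  · have h1 := (point_injective x).ne h
    split_ifs <;> first | (norm_num; done) | grind

theorem compatible_code (x : ZSpace n) : Compatible (code x) := fun r hr => by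
  rw [eval_code x hr]
  exact not_isUnit_zero

namespace Compatible

variable {v w : Gen n → Bool}

theorem single_bar (hv : Compatible v) (i : Signed n) : v (Gen.single (bar i)) = !v (Gen.single i) := by
  have := hv _ (Rel.bar_single i)
  simp only [map_sub, map_one, eval_X, toPoint] at this
  cases h : v (Gen.single (bar i)) <;> cases h' : v (Gen.single i) <;> simp_all

theorem pair_symm (hv : Compatible v) {i j : Signed n} (h : i ≠ j) :
    v (Gen.pair j i h.symm) = !v (Gen.pair i j h) := by
  have := hv _ (Rel.antisymm i j h)
  simp only [map_sub, map_one, eval_X, toPoint] at this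
  cases h1 : v (Gen.pair j i h.symm) <;> cases h2 : v (Gen.pair i j h) <;> simp_all

theorem pair_trans (hv : Compatible v) {i j k : Signed n} (hij : i ≠ j) (hjk : j ≠ k) (hik : i ≠ k)
    (h1 : v (Gen.pair i j hij) = true) (h2 : v (Gen.pair j k hjk) = true) :
    v (Gen.pair i k hik) = true := by
  have := hv _ (Rel.triple i j k hij hjk hik)
  by_contra h3
  simp_all [toPoint]

theorem pair_of_pos_of_neg (hv : Compatible v) {i j : Signed n} (h : i ≠ j)
    (hi : v (Gen.single i) = true)
    (hj : v (Gen.single j) = false) : v (Gen.pair i j h) = false := by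
  have := hv _ (Rel.mixed_single i j h)
  by_contra h3
  simp_all [toPoint]

/-- Equal signs are essential: the relation then takes the value `±1` when violated, whereas in
general it could be `±2`, which is not a unit. -/
theorem pair_bar (hv : Compatible v) {i j : Signed n} (h : i ≠ j)
    (hij : v (Gen.single i) = v (Gen.single j)) :
    v (Gen.pair (bar i) (bar j) (bar_ne h)) = v (Gen.pair i j h) := by
  have := hv _ (Rel.bar_pair i j h)
  simp only [map_sub, map_add, eval_X, toPoint, hij] at this
  cases h1 : v (Gen.pair (bar i) (bar j) (bar_ne h)) <;> cases h2 : v (Gen.pair i j h) <;> simp_all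

/-- A compatible vector is determined by the signs and the order of the positive points. -/
theorem ext (hv : Compatible v) (hw : Compatible w)
    (hs : ∀ i, v (Gen.single (Sum.inl i)) = w (Gen.single (Sum.inl i)))
    (hp : ∀ i j (h : i ≠ j), v (Gen.single i) = true → v (Gen.single j) = true →
      v (Gen.pair i j h) = w (Gen.pair i j h)) : v = w := by
  have hs' : ∀ i, v (Gen.single i) = w (Gen.single i) := by
    rintro (i | i)
    · exact hs i
    · have h1 := hv.single_bar (Sum.inl i)
      have h2 := hw.single_bar (Sum.inl i)
      rw [hs i, ← h2] at h1
      exact h1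
  funext g
  rcases g with ⟨i, j, h⟩ | i
  · cases hi : v (Gen.single i) <;> cases hj : v (Gen.single j)
    -- Two negative points are compared through their barred, positive partners; in the next two
    -- cases the signs alone fix the order.
    · rw [← hv.pair_bar h (by rw [hi, hj]), ← hw.pair_bar h (by rw [← hs', ← hs', hi, hj])]
      exact hp _ _ _ (by rw [hv.single_bar, hi]; rfl) (by rw [hv.single_bar, hj]; rfl)
    · have h1 := hv.pair_symm h.symm
      have h2 := hw.pair_symm h.symm
      rw [hv.pair_of_pos_of_neg h.symm hj hi] at h1
      rw [hw.pair_of_pos_of_neg h.symm (by rw [← hs', hj]) (by rw [← hs', hi])] at h2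
      rw [h1, h2]
    · rw [hv.pair_of_pos_of_neg h hi hj,
        hw.pair_of_pos_of_neg h (by rw [← hs', hi]) (by rw [← hs', hj])]
    · exact hp i j h hi hj
  · exact hs' i

end Compatible

/-! ### Realising compatible vectors by configurations -/

/-- The representative of `i` that is positive according to `v`. -/
def posIndex (v : Gen n → Bool) (i : Fin n) : Signed n :=
  if v (Gen.single (Sum.inl i)) then Sum.inl i else Sum.inr i

theorem posIndex_injective (v : Gen n → Bool) : Function.Injective (posIndex v) := by
  intro i j h
  unfold posIndex at h
  split_ifs at h <;> simpa using h

theorem Compatible.exists_posIndex {v : Gen n → Bool} (hv : Compatible v) {k : Signed n}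
    (hk : v (Gen.single k) = true) : ∃ i, k = posIndex v i := by
  rcases k with i | i
  · exact ⟨i, by simp [posIndex, hk]⟩
  · refine ⟨i, ?_⟩
    have := hv.single_bar (Sum.inr i)
    simp only [bar, Sum.swap_inr, hk] at this
    simp [posIndex, this]

/-- The order of the positive points according to `v`. -/
def Precedes (v : Gen n → Bool) (i j : Fin n) : Prop :=
  ∃ h : i ≠ j, v (Gen.pair _ _ ((posIndex_injective v).ne h)) = true

namespace Compatible

variable {v : Gen n → Bool}

theorem not_precedes (hv : Compatible v) {i j : Fin n} (h : Precedes v i j) : ¬ Precedes v j i := by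
  rintro ⟨_, h2⟩
  obtain ⟨h1, h3⟩ := h
  rw [hv.pair_symm ((posIndex_injective v).ne h1), h3] at h2
  exact absurd h2 (by simp)

theorem precedes_trans (hv : Compatible v) {i j k : Fin n} (h1 : Precedes v i j) (h2 : Precedes v j k) :
    Precedes v i k := by
  have hik : i ≠ k := by rintro rfl; exact hv.not_precedes h1 h2
  exact ⟨hik, hv.pair_trans _ _ _ h1.2 h2.2⟩

theorem precedes_or (hv : Compatible v) {i j : Fin n} (h : i ≠ j) : Precedes v i j ∨ Precedes v j i := by
  have := hv.pair_symm ((posIndex_injective v).ne h)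
  cases e : v (Gen.pair _ _ ((posIndex_injective v).ne h))
  · exact Or.inr ⟨h.symm, by rw [this, e]; rfl⟩
  · exact Or.inl ⟨h, e⟩

open Classical in
/-- The number of positive points preceding a given one. -/
noncomputable def rank (v : Gen n → Bool) (i : Fin n) : ℕ := {j | Precedes v j i}.toFinset.card

end Compatible

open Compatible

/-- The predecessors of `i` are also predecessors of `j`, and `i` itself is a further one. -/
theorem Compatible.rank_lt {v : Gen n → Bool} (hv : Compatible v) {i j : Fin n}
    (h : Precedes v i j) : rank v i < rank v j := by
  classical
  refine Finset.card_lt_card (Finset.ssubset_iff_of_subset (fun k hk => ?_) |>.2 ⟨i, ?_, ?_⟩)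
  · rw [Set.mem_toFinset] at hk ⊢
    exact hv.precedes_trans hk h
  · rw [Set.mem_toFinset]
    exact h
  · rw [Set.mem_toFinset]
    rintro ⟨h, -⟩
    exact h rfl

theorem Compatible.rank_lt_iff {v : Gen n → Bool} (hv : Compatible v) {i j : Fin n} :
    rank v i < rank v j ↔ Precedes v i j := by
  refine ⟨fun h => ?_, hv.rank_lt⟩
  have hne : i ≠ j := by rintro rfl; exact lt_irrefl _ h
  exact (hv.precedes_or hne).resolve_right fun h' => lt_asymm h (hv.rank_lt h')

theorem Compatible.rank_injective {v : Gen n → Bool} (hv : Compatible v) :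
    Function.Injective fun i => (rank v i : ℝ) := by
  intro i j h
  by_contra hne
  rcases hv.precedes_or hne with h' | h'
  · exact (hv.rank_lt h').ne (Nat.cast_injective h)
  · exact (hv.rank_lt h').ne' (Nat.cast_injective h)

/-- The Heaviside values of configurations are exactly the compatible Boolean vectors. -/
theorem Compatible.mem_range_code {v : Gen n → Bool} (hv : Compatible v) :
    v ∈ Set.range (code (n := n)) := by
  have hsgn : ∀ i, (if v (Gen.single (Sum.inl i)) then (1 : ℝ) else -1) = 1 ∨
      (if v (Gen.single (Sum.inl i)) then (1 : ℝ) else -1) = -1 := fun i => by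
    split_ifs <;> simp
  -- Signs are read off from `v`, and ranks are the logarithmic coordinates, so the positive
  -- representative of `i` lies at `exp (rank v i)`.
  let x : ZSpace n := ofCoords _ _ hsgn hv.rank_injective
  have hx : ∀ i, point x (posIndex v i) = Real.exp (rank v i) := fun i => by
    rw [← place_one]
    cases h : v (Gen.single (Sum.inl i))
    · have e : posIndex v i = Sum.inr i := by simp [posIndex, h]
      rw [e]
      change phi (place _ _) = _
      rw [phi_place (hsgn i)]
      simp [h]
    · have e : posIndex v i = Sum.inl i := by simp [posIndex, h]
      rw [e]
      change place _ _ = _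
      simp [h]
  refine ⟨x, (hv.ext (compatible_code x) (fun i => ?_) fun k l h hk hl => ?_).symm⟩
  · rw [Bool.eq_iff_iff, code_single]
    change _ ↔ 0 < place _ _
    rw [place_pos_iff (hsgn i)]
    cases h : v (Gen.single (Sum.inl i))
    · norm_num
    · simp
  · obtain ⟨i, rfl⟩ := hv.exists_posIndex hk
    obtain ⟨j, rfl⟩ := hv.exists_posIndex hl
    rw [Bool.eq_iff_iff, code_pair, hx, hx, Real.exp_lt_exp, Nat.cast_lt, hv.rank_lt_iff]
    exact ⟨fun e => ⟨fun hij => h (congrArg _ hij), e⟩, fun e => e.2⟩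

theorem exists_quotientEquiv (n : ℕ) :
    ∃ e : (MvPolynomial (Gen n) ℤ ⧸ J n) ≃+* (Set.range (code (n := n)) → ℤ),
      ∀ p, e (Ideal.Quotient.mk _ p) = evalOn _ p := by
  have := Fintype.ofFinite (Gen n)
  refine exists_equiv (fun g => ?_) ?_ fun v hv => ?_
  · rcases g with ⟨i, j, h⟩ | i
    · exact Ideal.subset_span (Rel.idem_pair i j h)
    · exact Ideal.subset_span (Rel.idem_single i)
  · rintro _ ⟨x, rfl⟩ r hr
    exact eval_code x hr
  · by_contra! h
    exact hv (Compatible.mem_range_code fun r hr => h r hr)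

end OrbitConfiguration

theorem mainTheorem6 (n : ℕ) :
    ∃ Φ : (MvPolynomial (OrbitConfiguration.Gen n) ℤ ⧸ OrbitConfiguration.J n) ≃+*
        SingularCohomology (OrbitConfiguration.ZSpace n),
      (∀ (i j : OrbitConfiguration.Signed n) (h : i ≠ j),
        IsClassOf (OrbitConfiguration.heavisidePair i j)
          (Φ (Ideal.Quotient.mk (OrbitConfiguration.J n) (OrbitConfiguration.zz i j h)))) ∧
      ∀ i : OrbitConfiguration.Signed n,
        IsClassOf (OrbitConfiguration.heavisideSingle i)
          (Φ (Ideal.Quotient.mk (OrbitConfiguration.J n) (OrbitConfiguration.z i))) := by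
  obtain ⟨e, he⟩ := OrbitConfiguration.exists_quotientEquiv n
  -- Every polynomial `p` goes to the class of `x ↦ p(code x)`; the two claims are the cases of a
  -- single variable.
  have key : ∀ p, IsClassOf
      (fun x => MvPolynomial.eval (BooleanQuotient.toPoint (OrbitConfiguration.code x)) p)
      (e.trans (OrbitConfiguration.contraction.cohomologyEquiv
        OrbitConfiguration.component_surjective) (Ideal.Quotient.mk _ p)) := fun p => by
    rw [RingEquiv.trans_apply, he]
    exact OrbitConfiguration.contraction.isClassOf_toCohomology (BooleanQuotient.evalOn _ p)
  refine ⟨e.trans (OrbitConfiguration.contraction.cohomologyEquiv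
    OrbitConfiguration.component_surjective), fun i j h => ?_, fun i => ?_⟩
  · convert key (MvPolynomial.X _) using 1
    funext x
    simp only [MvPolynomial.eval_X, BooleanQuotient.toPoint, OrbitConfiguration.code_pair,
      OrbitConfiguration.heavisidePair]
  · convert key (MvPolynomial.X _) using 1
    funext x
    simp only [MvPolynomial.eval_X, BooleanQuotient.toPoint, OrbitConfiguration.code_single,
      OrbitConfiguration.heavisideSingle]
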